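/- Let $A,D\in\mathbb C^{n\times n}$ and let $\lambda_0$ be an eigenvalue of $A$ whose largest Jordan block has size $k\ge 1$; for $1\le j\le k$ let $s_j\ge 0$ be the number of Jordan blocks of size $j$ of $A$ for $\lambda_0$ (so $s_k>0$). Let $[\Xi\ \ \Xi_c]\in\mathbb C^{n\times n}$ be invertible, $[\Sigma\ \ \Sigma_c]=[\Xi\ \ \Xi_c]^{-*}$, with $$A[\Xi\ \ \Xi_c]=[\Xi\ \ \Xi_c]\begin{bmatrix}\lambda_0I+N&0\\0&A_{22}\end{bmatrix},\qquad N=\operatorname{diag}(N_1,\dots,N_k),\qquad \lambda_0\notin\Lambda(A_{22}),$$ where $N_j$ is the $j\times j$ block matrix with blocks of size $s_j\times s_j$, equal to $I_{s_j}$ on the first block superdiagonal and $0$ elsewhere. Partition conformally $\Xi=[\Xi_1\ \cdots\ \Xi_k]$, $\Xi_j=[\Xi_{j1}\ \cdots\ \Xi_{jj}]$, $\Sigma=[\Sigma_1\ \cdots\ \Sigma_k]$, $\Sigma_j=[\Sigma_{j1}\ \cdots\ \Sigma_{jj}]$, where each $\Xi_{jm},\Sigma_{jm}$ has $s_j$ columns.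 Put $$W_i=[\Sigma_{ii}\ \Sigma_{i+1,i+1}\ \cdots\ \Sigma_{kk}]^*\,D\,[\Xi_{i1}\ \Xi_{i+1,1}\ \cdots\ \Xi_{k1}],\qquad i=1,\dots,k,$$ and assume that $W_1,\dots,W_k$ are all invertible. Let $$\Theta_k=\begin{bmatrix}0&I_{s_k}&&\\&0&\ddots&\\&&\ddots&I_{s_k}\\W_k&&&0\end{bmatrix}\in\mathbb C^{ks_k\times ks_k}\qquad(\Theta_1=W_1\text{ if }k=1).$$ Let $\widetilde\Phi\in\mathbb C^{ks_k\times r}$ have rank $r$ and satisfy $\Theta_k\widetilde\Phi=\widetilde\Phi\,\Omega$ with $\Omega\in\mathbb C^{r\times r}$, and assume that the eigenvalues of $\Omega$ are different from the remaining eigenvalues of $\Theta_k$ (the multiset of eigenvalues of $\Theta_k$ minus the multiset of eigenvalues of $\Omega$, both counted with algebraic multiplicity, contains no eigenvalue of $\Omega$). Let $Q_1\in\mathbb C^{s_k\times r}$ be the first block row of $\widetilde\Phi$, so that $\widetilde\Phi=[Q_1^T\ (Q_1\Omega)^T\ \cdots\ (Q_1\Omega^{k-1})^T]^T$. Then there are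 matrices $C=C(t)\in\mathbb C^{r\times r}$ and $H=H(t)\in\mathbb C^{n\times r}$ such that, for all sufficiently small $t>0$, $$(A+tD)H=HC,\qquad C=\lambda_0I+t^{1/k}\Omega+O(t^{2/k}),\qquad H=\Xi_{k1}Q_1+\sum_{i=1}^k\Xi_iH_i+O(t),$$ where, with $H_i=H_i(t)$ partitioned into $i$ block rows of height $s_i$, $$H_i=O\left(\begin{bmatrix}t^{1-i/k}&t^{1-(i-1)/k}&\cdots&t^{1-1/k}\end{bmatrix}^T\right),\qquad 1\le i\le k-1,$$ $$H_k=\begin{bmatrix}0&(Q_1(t^{1/k}\Omega))^T&\cdots&(Q_1(t^{1/k}\Omega)^{k-1})^T\end{bmatrix}^T+O\left(\begin{bmatrix}t^{1/k}&t^{2/k}&\cdots&t\end{bmatrix}^T\right).$$ Here $O(t^c)$ is a matrix bounded in norm by a constant times $t^c$ as $t\to0^+$, and $O$ of a column of powers gives the order of each block row. -/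

import Mathlib

open Filter Topology Asymptotics

noncomputable section

namespace JordanPert

/-- Indices of the part of the Jordan form that belongs to the single eigenvalue `lam0`, with
`s j` Jordan blocks of size `j` for `1 ≤ j ≤ k`. The index `⟨j, m, p⟩` is position `p` inside
the `(m+1)`-st block (each of width `s j`) of the `j`-th diagonal block. -/
abbrev JIdx (k : ℕ) (s : ℕ → ℕ) : Type :=
  Σ j : Finset.Icc 1 k, Fin (j : ℕ) × Fin (s j)

/-- The index of the largest Jordan block size `k`. -/
abbrev top {k : ℕ} (hk : 1 ≤ k) : Finset.Icc 1 k := ⟨k, Finset.mem_Icc.mpr ⟨hk, le_rfl⟩⟩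

/-- The first block position inside the `j`-th diagonal block. -/
def firstPos {k : ℕ} (j : Finset.Icc 1 k) : Fin (j : ℕ) :=
  ⟨0, (Finset.mem_Icc.mp j.2).1⟩

/-- The last block position inside the `j`-th diagonal block. -/
def lastPos {k : ℕ} (j : Finset.Icc 1 k) : Fin (j : ℕ) :=
  ⟨(j : ℕ) - 1, Nat.sub_lt (Finset.mem_Icc.mp j.2).1 Nat.one_pos⟩

/-- `N = diag(N_1, …, N_k)`, where `N_j` is `j × j` block matrix with the identity of size `s j`
on the block superdiagonal and zeros elsewhere. -/
def nilpotentPart (k : ℕ) (s : ℕ → ℕ) : Matrix (JIdx k s) (JIdx k s) ℂ :=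
  Matrix.of fun x y =>
    if x.1 = y.1 ∧ (x.2.1 : ℕ) + 1 = (y.2.1 : ℕ) ∧ (x.2.2 : ℕ) = (y.2.2 : ℕ) then 1 else 0

/-- The block column `M_j` of `M = [M_1 … M_k]`. -/
def blockCol {n k : ℕ} {s : ℕ → ℕ} (M : Matrix (Fin n) (JIdx k s) ℂ) (j : Finset.Icc 1 k) :
    Matrix (Fin n) (Fin (j : ℕ) × Fin (s j)) ℂ :=
  M.submatrix id fun y => ⟨j, y⟩

/-- The sub-block column `M_{j,m+1}` of `M_j = [M_{j1} … M_{jj}]`. -/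
def subCol {n k : ℕ} {s : ℕ → ℕ} (M : Matrix (Fin n) (JIdx k s) ℂ) (j : Finset.Icc 1 k)
    (m : Fin (j : ℕ)) : Matrix (Fin n) (Fin (s j)) ℂ :=
  M.submatrix id fun p => ⟨j, (m, p)⟩

/-- Column indices of `[M_{i,·} M_{i+1,·} … M_{k,·}]`, one sub-block column for each size `≥ i`. -/
abbrev EIdx (k : ℕ) (s : ℕ → ℕ) (i : Finset.Icc 1 k) : Type :=
  Σ j : {j : Finset.Icc 1 k // i ≤ j}, Fin (s j.1)

/-- `[Xi_{i1} Xi_{i+1,1} … Xi_{k1}]`: right eigenvectors of the Jordan blocks of size `≥ i`. -/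
def tildeXi {n k : ℕ} {s : ℕ → ℕ} (Xi : Matrix (Fin n) (JIdx k s) ℂ) (i : Finset.Icc 1 k) :
    Matrix (Fin n) (EIdx k s i) ℂ :=
  Matrix.of fun a x => subCol Xi x.1.1 (firstPos x.1.1) a x.2

/-- `[Sg_{ii} Sg_{i+1,i+1} … Sg_{kk}]`: left eigenvectors of the Jordan blocks of size `≥ i`. -/
def tildeSg {n k : ℕ} {s : ℕ → ℕ} (Sg : Matrix (Fin n) (JIdx k s) ℂ) (i : Finset.Icc 1 k) :
    Matrix (Fin n) (EIdx k s i) ℂ :=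
  Matrix.of fun a x => subCol Sg x.1.1 (lastPos x.1.1) a x.2

open Matrix in
/-- `W_i`, the compression of `D` to the eigenvectors of the Jordan blocks of size `≥ i`. -/
def W {n k : ℕ} {s : ℕ → ℕ} (D : Matrix (Fin n) (Fin n) ℂ) (Xi Sg : Matrix (Fin n) (JIdx k s) ℂ)
    (i : Finset.Icc 1 k) : Matrix (EIdx k s i) (EIdx k s i) ℂ :=
  (tildeSg Sg i)ᴴ * D * tildeXi Xi i

open Matrix in
/-- `S_k = Sg_{kk}^* D Xi_{k1}`, which is `W_k` written with index type `Fin (s k)`. -/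
def topS {n k : ℕ} {s : ℕ → ℕ} (hk : 1 ≤ k) (D : Matrix (Fin n) (Fin n) ℂ)
    (Xi Sg : Matrix (Fin n) (JIdx k s) ℂ) : Matrix (Fin (s k)) (Fin (s k)) ℂ :=
  (subCol Sg (top hk) (lastPos (top hk)))ᴴ * D * subCol Xi (top hk) (firstPos (top hk))

/-- The `k × k` block companion matrix with identities on the block superdiagonal and `S` in the
lower left corner (equal to `S` when `k = 1`). -/
def blockCompanion (k q : ℕ) (S : Matrix (Fin q) (Fin q) ℂ) :
    Matrix (Fin k × Fin q) (Fin k × Fin q) ℂ :=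
  Matrix.of fun x y =>
    (if (x.1 : ℕ) + 1 = (y.1 : ℕ) ∧ x.2 = y.2 then 1 else 0) +
      (if (x.1 : ℕ) + 1 = k ∧ (y.1 : ℕ) = 0 then S x.2 y.2 else 0)

/-- The first block row of a matrix with `k ≥ 1` block rows of height `q`. -/
def topRow {k q r : ℕ} (hk : 1 ≤ k) (Phi : Matrix (Fin k × Fin q) (Fin r) ℂ) :
    Matrix (Fin q) (Fin r) ℂ :=
  Phi.submatrix (fun p => (⟨0, hk⟩, p)) id

/-- `F(t) = O(t ^ c)` as `t → 0+`, entrywise (equivalently, in any matrix norm). -/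
def MatBigO {ι κ : Type*} (F : ℝ → Matrix ι κ ℂ) (c : ℝ) : Prop :=
  ∀ a b, (fun t : ℝ => F t a b) =O[𝓝[>] (0 : ℝ)] fun t : ℝ => t ^ c

/-- The block row `M_{m+1}` of a matrix partitioned into `i` block rows of height `q`. -/
def blockRow {i q r : ℕ} (M : Matrix (Fin i × Fin q) (Fin r) ℂ) (m : Fin i) :
    Matrix (Fin q) (Fin r) ℂ :=
  M.submatrix (fun p => (m, p)) id

end JordanPert

end

noncomputable section

namespace JordanPert
open Matrix

/-! Put e = t^(1/k). In the basis `[Xi Xic]` the matrix A + tD - lam0 becomes diag(N, B) + e^k K,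
where B = A22 - lam0 is invertible. Weight position m (counted from 0) of a Jordan chain of length j
by e^(k-j+m), and the complementary rows by e^k. Dividing powers of e out of the rows turns the
eigenvalue equation into pencil(e) U = pencilId(e) U Om, polynomial in e, with C = lam0 + e Om
(`unscaled_mul_scaling`, `rowScaling_mul_pencilId`).

At e = 0, K acts only from the first positions of the longest chains into the ends of chains and the
complementary rows. The longest chains therefore form a closed system with matrix Theta_k, solved by
Phi and Omega; all other rows follow from Q_1 because Omega and B are invertible
(`pencil_mul_leading`).

A normalization L U_top = 1 removes the freedom of changing basis. With it the linearization at e =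
0 is injective, since Omega shares no eigenvalue with the rest of Theta_k
(`exists_leftInverse_of_simple_invariant`, `pencil_linearization_injective`). The implicit function
theorem yields U = U0 + O(e) and Om = Omega + O(e), and undoing the weights gives the stated powers
of t. -/

/-! ### Sylvester equations and simple invariant subspaces. -/

theorem aeval_mul_eq_mul_aeval {ι κ : Type*} [Fintype ι] [DecidableEq ι] [Fintype κ]
    [DecidableEq κ] {A : Matrix ι ι ℂ} {B : Matrix κ κ ℂ} {X : Matrix ι κ ℂ}
    (h : A * X = X * B) (p : Polynomial ℂ) :
    Polynomial.aeval A p * X = X * Polynomial.aeval B p := by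
  induction p using Polynomial.induction_on' with
  | add p q hp hq => simp [Matrix.add_mul, Matrix.mul_add, hp, hq]
  | monomial n a =>
    have hpow : A ^ n * X = X * B ^ n := by
      induction n with
      | zero => simp
      | succ n ih => rw [pow_succ, pow_succ, Matrix.mul_assoc, h, ← Matrix.mul_assoc, ih,
          Matrix.mul_assoc]
    rw [Polynomial.aeval_monomial, Polynomial.aeval_monomial, ← Algebra.smul_def,
      ← Algebra.smul_def, Matrix.smul_mul, Matrix.mul_smul, hpow]

/-- A homogeneous Sylvester equation between matrices without common eigenvalue has only the zero
solution. -/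
theorem eq_zero_of_mul_eq_mul {ι κ : Type*} [Fintype ι] [DecidableEq ι] [Fintype κ]
    [DecidableEq κ] {A : Matrix ι ι ℂ} {B : Matrix κ κ ℂ} {X : Matrix ι κ ℂ}
    (h : A * X = X * B) (hAB : ∀ μ ∈ B.charpoly.roots, μ ∉ A.charpoly.roots) : X = 0 := by
  -- Disjoint spectra give a χ_B + b χ_A = 1. At A this reads a(A) χ_B(A) = 1, while χ_B(A) X = X
  -- χ_B(B) = 0.
  have hcop : IsCoprime B.charpoly A.charpoly := by
    refine (Polynomial.isCoprime_iff_aeval_ne_zero_of_isAlgClosed ℂ ℂ _ _).2 fun μ => ?_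
    by_contra! hμ
    refine hAB μ ?_ ?_
    · rw [Polynomial.mem_roots (B.charpoly_monic.ne_zero)]; simpa using hμ.1
    · rw [Polynomial.mem_roots (A.charpoly_monic.ne_zero)]; simpa using hμ.2
  obtain ⟨a, b, hab⟩ := hcop
  have h1 : Polynomial.aeval A (a * B.charpoly) = 1 := by
    have := congrArg (Polynomial.aeval A) hab
    simpa [Matrix.aeval_self_charpoly] using this
  have h2 : Polynomial.aeval A (a * B.charpoly) * X = 0 := by
    rw [aeval_mul_eq_mul_aeval h]
    simp [Matrix.aeval_self_charpoly]
  simpa [h1] using h2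

theorem exists_basis_sum_extending.{u, v} {ι : Type u} {V : Type v} [AddCommGroup V] [Module ℂ V]
    [FiniteDimensional ℂ V] {v : ι → V} (hv : LinearIndependent ℂ v) :
    ∃ (κ : Type v) (_ : Fintype κ) (b : Module.Basis (ι ⊕ κ) ℂ V), ∀ j, b (Sum.inl j) = v j := by
  have : Finite (ι ⊕ Module.Basis.sumExtendIndex hv) :=
    Module.Finite.finite_basis (Module.Basis.sumExtend hv)
  have : Finite (Module.Basis.sumExtendIndex hv) :=
    Finite.of_injective (Sum.inr : _ → ι ⊕ Module.Basis.sumExtendIndex hv) Sum.inr_injective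
  refine ⟨_, Fintype.ofFinite (Module.Basis.sumExtendIndex hv), Module.Basis.sumExtend hv, ?_⟩
  intro j
  simp only [Module.Basis.sumExtend, Module.Basis.reindex_apply, Module.Basis.extend_apply_self]
  rfl

/-- A simple invariant subspace of `T` with basis matrix `Phi`: some left inverse `L` of `Phi`
makes the linearized eigenvalue equation uniquely solvable. -/
theorem exists_leftInverse_of_simple_invariant {ι : Type*} [Fintype ι] [DecidableEq ι] {r : ℕ}
    {T : Matrix ι ι ℂ} {Phi : Matrix ι (Fin r) ℂ} {Omega : Matrix (Fin r) (Fin r) ℂ}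
    (hrank : Phi.rank = r) (hPhi : T * Phi = Phi * Omega)
    (hOmega : ∀ μ ∈ Omega.charpoly.roots, μ ∉ T.charpoly.roots - Omega.charpoly.roots) :
    ∃ L : Matrix (Fin r) ι ℂ, L * Phi = 1 ∧ ∀ (X : Matrix ι (Fin r) ℂ)
      (G : Matrix (Fin r) (Fin r) ℂ), T * X - X * Omega = Phi * G → L * X = 0 → X = 0 ∧ G = 0 := by
  classical
  have hli : LinearIndependent ℂ Phi.col := by
    rw [linearIndependent_iff_card_eq_finrank_span, Set.finrank, ← Matrix.rank_eq_finrank_span_cols,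
      hrank, Fintype.card_fin]
  obtain ⟨κ, _, b, hb⟩ := exists_basis_sum_extending hli
  -- The basis starts with the columns of Phi, so R T P is block upper triangular with Omega in its
  -- upper left corner.
  let P : Matrix ι (Fin r ⊕ κ) ℂ := (Pi.basisFun ℂ ι).toMatrix b
  let R : Matrix (Fin r ⊕ κ) ι ℂ := b.toMatrix (Pi.basisFun ℂ ι)
  have hPR : P * R = 1 := Module.Basis.toMatrix_mul_toMatrix_flip _ _
  have hRP : R * P = 1 := Module.Basis.toMatrix_mul_toMatrix_flip _ _
  let M := LinearMap.toMatrix b b (Matrix.toLin' T)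
  have hM : M.charpoly = T.charpoly := by
    rw [LinearMap.charpoly_toMatrix, ← LinearMap.charpoly_toMatrix _ (Pi.basisFun ℂ ι)]
    congr 1
    exact LinearMap.toMatrix'_toLin' T
  have hMR : R * T = M * R := by
    have h1 : LinearMap.toMatrix (Pi.basisFun ℂ ι) b (Matrix.toLin' T) = R * T := by
      rw [← basis_toMatrix_mul_linearMap_toMatrix (b' := Pi.basisFun ℂ ι) (c := b)
        (c' := Pi.basisFun ℂ ι)]
      congr 1
      exact LinearMap.toMatrix'_toLin' T
    have h2 : LinearMap.toMatrix (Pi.basisFun ℂ ι) b (Matrix.toLin' T) = M * R :=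
      (linearMap_toMatrix_mul_basis_toMatrix _ _ _ _).symm
    rw [← h1, h2]
  have hPhiP : Phi = P.submatrix id Sum.inl := by
    ext x j
    simp [P, Module.Basis.toMatrix_apply, hb]
  have hRPhi : R * Phi = (1 : Matrix (Fin r ⊕ κ) (Fin r ⊕ κ) ℂ).submatrix id Sum.inl := by
    rw [hPhiP, ← hRP]; rfl
  have hL : R.submatrix Sum.inl id * Phi = 1 := by
    have : R.submatrix Sum.inl id * Phi = (R * Phi).submatrix Sum.inl id := rfl
    rw [this, hRPhi]
    ext i j
    simp [Matrix.one_apply]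
  have hL2 : R.submatrix Sum.inr id * Phi = 0 := by
    have : R.submatrix Sum.inr id * Phi = (R * Phi).submatrix Sum.inr id := rfl
    rw [this, hRPhi]
    ext i j
    simp
  have hMcol : M.submatrix id Sum.inl = (R * Phi) * Omega := by
    have : M.submatrix id Sum.inl = M * (1 : Matrix (Fin r ⊕ κ) (Fin r ⊕ κ) ℂ).submatrix id Sum.inl := by
      ext i j; simp [Matrix.mul_apply, Matrix.one_apply]
    rw [this, ← hRPhi, ← Matrix.mul_assoc, ← hMR, Matrix.mul_assoc, hPhi, Matrix.mul_assoc]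
  have h11 : M.toBlocks₁₁ = Omega := by
    have : M.toBlocks₁₁ = (R.submatrix Sum.inl id * Phi) * Omega := by
      change (M.submatrix id Sum.inl).submatrix Sum.inl id = _
      rw [hMcol]; rfl
    rw [this, hL, Matrix.one_mul]
  have h21 : M.toBlocks₂₁ = 0 := by
    have : M.toBlocks₂₁ = (R.submatrix Sum.inr id * Phi) * Omega := by
      change (M.submatrix id Sum.inl).submatrix Sum.inr id = _
      rw [hMcol]; rfl
    rw [this, hL2, Matrix.zero_mul]
  -- The characteristic polynomial factors over the triangular blocks, so the multiset difference is
  -- exactly the spectrum of the lower right block.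
  have hroots : T.charpoly.roots - Omega.charpoly.roots = M.toBlocks₂₂.charpoly.roots := by
    rw [← hM, ← Matrix.fromBlocks_toBlocks M, h11, h21, Matrix.charpoly_fromBlocks_zero₂₁,
      Polynomial.roots_mul (mul_ne_zero (Matrix.charpoly_monic _).ne_zero
        (Matrix.charpoly_monic _).ne_zero), add_tsub_cancel_left]
    simp
  refine ⟨R.submatrix Sum.inl id, hL, fun X G hX hLX => ?_⟩
  -- The lower rows of R annihilate Phi G, leaving a homogeneous Sylvester equation with disjoint
  -- spectra; L X = 0 disposes of the upper rows.
  have hX2 : R.submatrix Sum.inr id * X = 0 := by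
    refine eq_zero_of_mul_eq_mul (A := M.toBlocks₂₂) (B := Omega) ?_ (by rwa [← hroots])
    have e1 : R.submatrix Sum.inr id * T = M.toBlocks₂₂ * R.submatrix Sum.inr id := by
      have : R.submatrix Sum.inr id * T = (M * R).submatrix Sum.inr id := by rw [← hMR]; rfl
      rw [this]
      ext i j
      have := congrFun (congrFun h21 i)
      simp only [Matrix.toBlocks₂₁, Matrix.of_apply, Matrix.zero_apply] at this
      simp [Matrix.mul_apply, this, Matrix.toBlocks₂₂]
    have e2 : R.submatrix Sum.inr id * (T * X - X * Omega) = 0 := by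
      rw [hX, ← Matrix.mul_assoc, hL2, Matrix.zero_mul]
    rw [Matrix.mul_sub, ← Matrix.mul_assoc, e1, ← Matrix.mul_assoc, sub_eq_zero] at e2
    rw [← Matrix.mul_assoc, e2]
  have hRX : R * X = 0 := by
    ext i j
    rcases i with i | i
    · exact congrFun (congrFun hLX i) j
    · exact congrFun (congrFun hX2 i) j
  have hX0 : X = 0 := by
    rw [← Matrix.one_mul X, ← hPR, Matrix.mul_assoc, hRX, Matrix.mul_zero]
  refine ⟨hX0, ?_⟩
  rw [hX0] at hX
  rw [← Matrix.one_mul G, ← hL, Matrix.mul_assoc, ← hX]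
  simp

/-! ### Implicit function theorem for matrix pencils. -/

/-- Implicit function theorem for a square system whose linearization has trivial kernel. -/
theorem exists_implicit_solution {E : Type*} [NormedAddCommGroup E] [NormedSpace ℝ E]
    [FiniteDimensional ℝ E] {F : ℝ × E → E} {x0 : E} (hF : ContDiff ℝ 1 F) (h0 : F (0, x0) = 0)
    (hinj : ∀ v, HasDerivAt (fun s : ℝ => F (0, x0 + s • v)) 0 0 → v = 0) :
    ∃ x : ℝ → E, (∀ᶠ e in 𝓝 0, F (e, x e) = 0) ∧ (fun e => x e - x0) =O[𝓝 0] (fun e : ℝ => e) := by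
  have : CompleteSpace E := FiniteDimensional.complete ℝ E
  have hs : HasStrictFDerivAt F (fderiv ℝ F (0, x0)) (0, x0) :=
    hF.contDiffAt.hasStrictFDerivAt one_ne_zero
  have hker : ∀ v, ((fderiv ℝ F (0, x0)).comp (ContinuousLinearMap.inr ℝ ℝ E)) v = 0 → v = 0 := by
    intro v hv
    apply hinj
    have hline : HasDerivAt (fun s : ℝ => ((0 : ℝ), x0 + s • v)) (0, v) 0 := by
      refine (hasDerivAt_const _ _).prodMk ?_
      simpa using ((hasDerivAt_id (0 : ℝ)).smul_const v).const_add x0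
    have hF' : HasFDerivAt F (fderiv ℝ F (0, x0)) ((0 : ℝ), x0 + (0 : ℝ) • v) := by
      simpa using hs.hasFDerivAt
    have := hF'.comp_hasDerivAt (0 : ℝ) hline
    have hv' : (fderiv ℝ F (0, x0)) (0, v) = 0 := hv
    rw [hv'] at this
    exact this
  -- The partial derivative is an endomorphism of a finite-dimensional space, so injectivity
  -- suffices.
  have hinv : ((fderiv ℝ F (0, x0)).comp (ContinuousLinearMap.inr ℝ ℝ E)).IsInvertible := by
    set f := (fderiv ℝ F (0, x0)).comp (ContinuousLinearMap.inr ℝ ℝ E)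
    have hi : Function.Injective (f : E →ₗ[ℝ] E) :=
      (injective_iff_map_eq_zero _).2 hker
    exact ⟨(LinearEquiv.ofInjectiveEndo (f : E →ₗ[ℝ] E) hi).toContinuousLinearEquiv, by
      ext v; rfl⟩
  refine ⟨hs.implicitFunctionOfProdDomain hinv, ?_, ?_⟩
  · have := hs.eventually_apply_implicitFunctionOfProdDomain hinv
    simpa only [h0] using this
  · have h1 := (hs.hasStrictFDerivAt_implicitFunctionOfProdDomain hinv).hasFDerivAt.isBigO_sub
    have h2 := (hs.eventually_apply_eq_iff_implicitFunctionOfProdDomain hinv).self_of_nhds.1 rfl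
    simp only at h1 h2
    rw [h2] at h1
    simpa using h1

/-- The pencil system is quadratic in its unknowns, so along a line its residual is s a + s² b and
the linearization can be read off without a Fréchet derivative. -/
theorem hasDerivAt_quadratic {E : Type*} [NormedAddCommGroup E] [NormedSpace ℝ E] (a b : E) :
    HasDerivAt (fun s : ℝ => s • a + s ^ 2 • b) a 0 := by
  have h1 := (hasDerivAt_id (0 : ℝ)).smul_const a
  have h2 := (hasDerivAt_pow 2 (0 : ℝ)).smul_const b
  simpa using h1.fun_add h2

/-- Perturbation of a simple deflating pair: a solution of `G(0) U = P(0) U Ω`, normalized by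
`L U_f = 1` and isolated to first order, extends to nearby parameters. -/
theorem exists_pencil_solution {ι κ : Type*} [Fintype ι] [Fintype κ] {r : ℕ}
    {G P : ℝ → Matrix ι ι ℂ} (hG : ∀ a b, ContDiff ℝ 1 fun e => G e a b)
    (hP : ∀ a b, ContDiff ℝ 1 fun e => P e a b) (f : κ → ι) {L : Matrix (Fin r) κ ℂ}
    {U0 : Matrix ι (Fin r) ℂ} {Om : Matrix (Fin r) (Fin r) ℂ}
    (h0 : G 0 * U0 = P 0 * U0 * Om) (hL : L * U0.submatrix f id = 1)
    (hinj : ∀ (V : Matrix ι (Fin r) ℂ) (B : Matrix (Fin r) (Fin r) ℂ),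
      G 0 * V - P 0 * V * Om = P 0 * U0 * B → L * V.submatrix f id = 0 → V = 0 ∧ B = 0) :
    ∃ (U : ℝ → Matrix ι (Fin r) ℂ) (Om' : ℝ → Matrix (Fin r) (Fin r) ℂ),
      (∀ᶠ e in 𝓝 0, G e * U e = P e * U e * Om' e) ∧
      (∀ a b, (fun e => U e a b - U0 a b) =O[𝓝 0] fun e : ℝ => e) ∧
      (∀ a b, (fun e => Om' e a b - Om a b) =O[𝓝 0] fun e : ℝ => e) := by
  -- The residual of the pencil equation together with the normalization: as many equations as
  -- unknowns.
  let F : ℝ × ((ι → Fin r → ℂ) × (Fin r → Fin r → ℂ)) → ((ι → Fin r → ℂ) × (Fin r → Fin r → ℂ)) := fun x =>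
    (Matrix.of.symm (G x.1 * Matrix.of x.2.1 - P x.1 * Matrix.of x.2.1 * Matrix.of x.2.2),
      Matrix.of.symm (L * (Matrix.of x.2.1).submatrix f id - 1))
  have hF : ContDiff ℝ 1 F := by
    have hG' : ∀ a b, ContDiff ℝ 1 fun x : ℝ × ((ι → Fin r → ℂ) × (Fin r → Fin r → ℂ)) => G x.1 a b := fun a b =>
      (hG a b).comp contDiff_fst
    have hP' : ∀ a b, ContDiff ℝ 1 fun x : ℝ × ((ι → Fin r → ℂ) × (Fin r → Fin r → ℂ)) => P x.1 a b := fun a b =>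
      (hP a b).comp contDiff_fst
    refine ContDiff.prodMk ?_ ?_
    · refine contDiff_pi.2 fun a => contDiff_pi.2 fun b => ?_
      simp only [Matrix.of_symm_apply, Matrix.sub_apply, Matrix.mul_apply, Matrix.of_apply]
      fun_prop
    · refine contDiff_pi.2 fun a => contDiff_pi.2 fun b => ?_
      simp only [Matrix.of_symm_apply, Matrix.sub_apply, Matrix.mul_apply, Matrix.of_apply,
        Matrix.submatrix_apply]
      fun_prop
  let x0 : ((ι → Fin r → ℂ) × (Fin r → Fin r → ℂ)) := (Matrix.of.symm U0, Matrix.of.symm Om)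
  have hF0 : F (0, x0) = 0 := by
    change (Matrix.of.symm (G 0 * U0 - P 0 * U0 * Om),
      Matrix.of.symm (L * U0.submatrix f id - 1)) = (0 : ((ι → Fin r → ℂ) × (Fin r → Fin r → ℂ)))
    rw [h0, hL, sub_self, sub_self]
    rfl
  obtain ⟨x, hx, hxO⟩ := exists_implicit_solution (x0 := x0) hF hF0 (by
    rintro ⟨V, B⟩ hd
    let V' : Matrix ι (Fin r) ℂ := Matrix.of V
    let B' : Matrix (Fin r) (Fin r) ℂ := Matrix.of B
    let a : ((ι → Fin r → ℂ) × (Fin r → Fin r → ℂ)) := (Matrix.of.symm (G 0 * V' - P 0 * V' * Om - P 0 * U0 * B'),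
      Matrix.of.symm (L * V'.submatrix f id))
    let b : ((ι → Fin r → ℂ) × (Fin r → Fin r → ℂ)) := (Matrix.of.symm (-(P 0 * V' * B')), 0)
    have hline : (fun s : ℝ => F (0, x0 + s • (V, B))) = fun s : ℝ => s • a + s ^ 2 • b := by
      funext s
      have e1 : G 0 * (U0 + s • V') - P 0 * (U0 + s • V') * (Om + s • B') =
          s • (G 0 * V' - P 0 * V' * Om - P 0 * U0 * B') + s ^ 2 • (-(P 0 * V' * B')) := by
        simp only [Matrix.mul_add, Matrix.add_mul, h0, Matrix.mul_smul, Matrix.smul_mul]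
        module
      have e2 : L * (U0 + s • V').submatrix f id - 1 = s • (L * V'.submatrix f id) + s ^ 2 • 0 := by
        rw [Matrix.submatrix_add, Matrix.submatrix_smul]
        simp [Matrix.mul_add, hL]
      exact Prod.ext e1 e2
    rw [hline] at hd
    have ha : a = 0 := (hasDerivAt_quadratic a b).unique hd
    have ha1 : G 0 * V' - P 0 * V' * Om - P 0 * U0 * B' = 0 := congrArg Prod.fst ha
    have ha2 : L * V'.submatrix f id = 0 := congrArg Prod.snd ha
    obtain ⟨hV, hB⟩ := hinj V' B' (sub_eq_zero.1 ha1) ha2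
    exact Prod.ext hV hB)
  refine ⟨fun e => Matrix.of (x e).1, fun e => Matrix.of (x e).2, ?_, fun a b => ?_, fun a b => ?_⟩
  · filter_upwards [hx] with e he
    exact sub_eq_zero.1 (congrArg Prod.fst he)
  · refine IsBigO.trans (IsBigO.of_bound 1 (Eventually.of_forall fun e => ?_)) hxO
    rw [one_mul]
    exact ((norm_le_pi_norm ((x e - x0).1 a) b).trans (norm_le_pi_norm (x e - x0).1 a)).trans
      (norm_fst_le _)
  · refine IsBigO.trans (IsBigO.of_bound 1 (Eventually.of_forall fun e => ?_)) hxO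
    rw [one_mul]
    exact ((norm_le_pi_norm ((x e - x0).2 a) b).trans (norm_le_pi_norm (x e - x0).2 a)).trans
      (norm_snd_le _)

/-! ### Row action of N and of the block companion matrix. -/

theorem nilpotentPart_mul_apply {k r : ℕ} {s : ℕ → ℕ} (V : Matrix (JIdx k s) (Fin r) ℂ)
    (j : Finset.Icc 1 k) (m : Fin (j : ℕ)) (p : Fin (s j)) :
    (nilpotentPart k s * V) ⟨j, (m, p)⟩ =
      if h : (m : ℕ) + 1 < j then V ⟨j, (⟨m + 1, h⟩, p)⟩ else 0 := by
  funext c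
  rw [Matrix.mul_apply]
  split_ifs with h
  · rw [Fintype.sum_eq_single (⟨j, (⟨m + 1, h⟩, p)⟩ : JIdx k s)]
    · simp [nilpotentPart]
    · rintro ⟨j', m', p'⟩ hne
      simp only [nilpotentPart, Matrix.of_apply]
      rw [if_neg, zero_mul]
      rintro ⟨rfl, h2, h3⟩
      apply hne
      have e1 : m' = ⟨m + 1, h⟩ := Fin.ext h2.symm
      have e2 : p' = p := Fin.ext h3.symm
      rw [e1, e2]
  · refine Finset.sum_eq_zero ?_
    rintro ⟨j', m', p'⟩ -
    simp only [nilpotentPart, Matrix.of_apply]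
    rw [if_neg, zero_mul]
    rintro ⟨rfl, h2, -⟩
    exact h (h2 ▸ m'.2)

theorem blockCompanion_mul_apply {k q : ℕ} {κ : Type*} (hk : 1 ≤ k) (S : Matrix (Fin q) (Fin q) ℂ)
    (X : Matrix (Fin k × Fin q) κ ℂ) (m : Fin k) (p : Fin q) :
    (blockCompanion k q S * X) (m, p) =
      if h : (m : ℕ) + 1 < k then X (⟨m + 1, h⟩, p)
      else (S * X.submatrix (fun p => (⟨0, hk⟩, p)) id) p := by
  funext c
  rw [Matrix.mul_apply]
  split_ifs with h
  · rw [Fintype.sum_eq_single ((⟨m + 1, h⟩, p) : Fin k × Fin q)]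
    · have : (m : ℕ) + 1 ≠ k := h.ne
      simp [blockCompanion, this]
    · rintro ⟨m', p'⟩ hne
      have h1 : ¬ ((m : ℕ) + 1 = m' ∧ p = p') := by
        rintro ⟨h2, rfl⟩
        exact hne (by rw [show m' = ⟨m + 1, h⟩ from Fin.ext h2.symm])
      simp [blockCompanion, h1, h.ne]
  · have hm : (m : ℕ) + 1 = k := by omega
    rw [Fintype.sum_prod_type, Fintype.sum_eq_single (⟨0, hk⟩ : Fin k)]
    · simp only [blockCompanion, Matrix.of_apply, hm, Matrix.mul_apply, Matrix.submatrix_apply]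
      refine Finset.sum_congr rfl fun p' _ => ?_
      have : ¬ k = 0 := by omega
      simp [this]
    · intro m' hm'
      refine Finset.sum_eq_zero fun p' _ => ?_
      have h1 : ¬ k = m' := m'.2.ne'
      have h2 : ¬ (m' : ℕ) = 0 := fun h => hm' (Fin.ext h)
      simp [blockCompanion, hm, h1, h2]

/-- On a kernel vector, the last block row gives S v_0 = 0, and every other row says directly that
the next block vanishes. -/
theorem isUnit_blockCompanion {k q : ℕ} (hk : 1 ≤ k) {S : Matrix (Fin q) (Fin q) ℂ}
    (hS : IsUnit S) : IsUnit (blockCompanion k q S) := by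
  obtain ⟨k, rfl⟩ : ∃ k', k = k' + 1 := ⟨k - 1, by omega⟩
  rw [← mulVec_injective_iff_isUnit, ← Matrix.coe_mulVecLin, injective_iff_map_eq_zero]
  intro v hv
  have hX : blockCompanion (k + 1) q S * Matrix.of (fun x (_ : Unit) => v x) = 0 := by
    ext x u
    exact congrFun hv x
  have hrow := fun m p => congrFun (congrFun hX (m, p)) ()
  simp only [blockCompanion_mul_apply hk] at hrow
  funext x
  obtain ⟨m, p⟩ := x
  induction m using Fin.cases with
  | zero =>
    have h0 : S * (Matrix.of (fun x (_ : Unit) => v x)).submatrix (fun p => (⟨0, hk⟩, p)) id = 0 := by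
      ext p u
      simpa using hrow (Fin.last k) p
    have h1 := congrArg (fun M => S⁻¹ * M) h0
    simp only [← Matrix.mul_assoc,
      Matrix.nonsing_inv_mul _ ((Matrix.isUnit_iff_isUnit_det _).1 hS), Matrix.one_mul,
      Matrix.mul_zero] at h1
    exact congrFun (congrFun h1 p) ()
  | succ m =>
    have h := hrow m.castSucc p
    rw [dif_pos (by simp)] at h
    exact h

/-! ### Scaling by powers of e = t^(1/k). -/

/-- The power of `t ^ (1 / k)` carried by a row of the perturbed eigenvector matrix. -/
def scaleExp (k : ℕ) (s : ℕ → ℕ) (q : ℕ) : JIdx k s ⊕ Fin q → ℕ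
  | Sum.inl x => k - x.1 + x.2.1
  | Sum.inr _ => k

/-- The power of `t ^ (1 / k)` that can be divided out of a row of the eigenvalue equation. -/
def rowExp (k : ℕ) (s : ℕ → ℕ) (q : ℕ) : JIdx k s ⊕ Fin q → ℕ
  | Sum.inl x => k - x.1 + x.2.1 + 1
  | Sum.inr _ => k

theorem rowExp_le {k q : ℕ} {s : ℕ → ℕ} (x : JIdx k s ⊕ Fin q) : rowExp k s q x ≤ k := by
  rcases x with ⟨j, m, p⟩ | z
  · have h1 := m.2
    have h2 := (Finset.mem_Icc.1 j.2).2
    simp only [rowExp]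
    omega
  · exact le_rfl

/-- The rescaled matrix `diag(N, B) + e ^ k K`. -/
def pencil {k q : ℕ} {s : ℕ → ℕ} (B : Matrix (Fin q) (Fin q) ℂ)
    (K : Matrix (JIdx k s ⊕ Fin q) (JIdx k s ⊕ Fin q) ℂ) (e : ℝ) :
    Matrix (JIdx k s ⊕ Fin q) (JIdx k s ⊕ Fin q) ℂ :=
  fromBlocks (nilpotentPart k s) 0 0 B +
    Matrix.of fun x y => (e : ℂ) ^ (k - rowExp k s q x + scaleExp k s q y) * K x y

/-- The rescaled identity paired with `pencil`. -/
def pencilId (k : ℕ) (s : ℕ → ℕ) (q : ℕ) (e : ℝ) :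
    Matrix (JIdx k s ⊕ Fin q) (JIdx k s ⊕ Fin q) ℂ :=
  diagonal (Sum.elim (fun _ => 1) fun _ => (e : ℂ))

/-- The diagonal scaling of the rows of the eigenvector matrix. -/
def scaling (k : ℕ) (s : ℕ → ℕ) (q : ℕ) (e : ℝ) :
    Matrix (JIdx k s ⊕ Fin q) (JIdx k s ⊕ Fin q) ℂ :=
  diagonal fun x => (e : ℂ) ^ scaleExp k s q x

/-- N takes position m + 1 to position m, and the weight of the former is the row power of the
latter, so N passes through unchanged. In the perturbation no negative power remains, because row
powers are at most k. -/
theorem unscaled_mul_scaling {k q : ℕ} {s : ℕ → ℕ} (B : Matrix (Fin q) (Fin q) ℂ)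
    (K : Matrix (JIdx k s ⊕ Fin q) (JIdx k s ⊕ Fin q) ℂ) (e : ℝ) :
    (fromBlocks (nilpotentPart k s) 0 0 B + (e : ℂ) ^ k • K) * scaling k s q e =
      diagonal (fun x => (e : ℂ) ^ rowExp k s q x) * pencil B K e := by
  ext x y
  rw [scaling, Matrix.mul_diagonal, Matrix.diagonal_mul, pencil, Matrix.add_apply,
    Matrix.add_apply, Matrix.smul_apply, Matrix.of_apply, smul_eq_mul, add_mul, mul_add]
  congr 1
  · by_cases h : fromBlocks (nilpotentPart k s) 0 0 B x y = 0
    · simp [h]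
    · have : scaleExp k s q y = rowExp k s q x := by
        rcases x with ⟨j, m, p⟩ | x <;> rcases y with ⟨j', m', p'⟩ | y
        · simp only [fromBlocks_apply₁₁, nilpotentPart, Matrix.of_apply, ite_eq_right_iff,
            Classical.not_imp] at h
          obtain ⟨⟨rfl, h2, -⟩, -⟩ := h
          simp only [scaleExp, rowExp]
          omega
        · simp at h
        · simp at h
        · rfl
      rw [this, mul_comm]
  · have h : k = rowExp k s q x + (k - rowExp k s q x) := by
      have := rowExp_le x
      omega
    calc (e : ℂ) ^ k * K x y * (e : ℂ) ^ scaleExp k s q y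
        = (e : ℂ) ^ (rowExp k s q x + (k - rowExp k s q x)) * K x y
            * (e : ℂ) ^ scaleExp k s q y := by rw [← h]
      _ = _ := by rw [pow_add, pow_add]; ring

/-- On Jordan rows the row power exceeds the weight by one; on complementary rows they agree, and
the missing e sits in `pencilId`. -/
theorem rowScaling_mul_pencilId {k q : ℕ} {s : ℕ → ℕ} (e : ℝ) :
    diagonal (fun x => (e : ℂ) ^ rowExp k s q x) * pencilId k s q e =
      (e : ℂ) • scaling k s q e := by
  rw [pencilId, scaling, Matrix.diagonal_mul_diagonal, ← Matrix.diagonal_smul]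
  congr 1
  funext x
  rcases x with x | x
  · simp [rowExp, scaleExp, pow_succ, mul_comm]
  · simp [rowExp, scaleExp, mul_comm]

/-- The rows that carry the leading block `Q_1` of the eigenvector matrix. -/
def topIdx {k : ℕ} (hk : 1 ≤ k) (s : ℕ → ℕ) (q : ℕ) (p : Fin (s k)) : JIdx k s ⊕ Fin q :=
  Sum.inl ⟨top hk, (firstPos (top hk), p)⟩

theorem scaleExp_eq_zero {k q : ℕ} (hk : 1 ≤ k) {s : ℕ → ℕ} {x : JIdx k s ⊕ Fin q}
    (hx : scaleExp k s q x = 0) : ∃ p, x = topIdx hk s q p := by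
  rcases x with ⟨⟨j, hj⟩, m, p⟩ | z
  · simp only [scaleExp] at hx
    have h1 := (Finset.mem_Icc.1 hj).2
    obtain rfl : j = k := by omega
    refine ⟨p, ?_⟩
    have : m = firstPos (top hk) := Fin.ext (by simp only [firstPos]; omega)
    rw [this]; rfl
  · simp only [scaleExp] at hx
    omega

theorem scaleExp_topIdx {k q : ℕ} (hk : 1 ≤ k) {s : ℕ → ℕ} (p : Fin (s k)) :
    scaleExp k s q (topIdx hk s q p) = 0 := by
  simp [scaleExp, topIdx, top, firstPos]

theorem topIdx_injective {k : ℕ} (hk : 1 ≤ k) (s : ℕ → ℕ) (q : ℕ) :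
    Function.Injective (topIdx hk s q) := by
  intro p p' h
  simpa [topIdx] using h

/-! ### The limit pencil at e = 0. -/

/-- The exponent of e vanishes only when both its parts do: the row ends a chain or is
complementary, and the column is a first position in a longest chain. -/
theorem pencil_zero_mul {k q r : ℕ} (hk : 1 ≤ k) {s : ℕ → ℕ} (B : Matrix (Fin q) (Fin q) ℂ)
    (K : Matrix (JIdx k s ⊕ Fin q) (JIdx k s ⊕ Fin q) ℂ)
    (V : Matrix (JIdx k s ⊕ Fin q) (Fin r) ℂ) (x : JIdx k s ⊕ Fin q) :
    (pencil B K 0 * V) x = (fromBlocks (nilpotentPart k s) 0 0 B * V) x +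
      if rowExp k s q x = k then
        (K.submatrix id (topIdx hk s q) * V.submatrix (topIdx hk s q) id) x else 0 := by
  funext c
  rw [pencil, Matrix.add_mul, Matrix.add_apply, Pi.add_apply]
  congr 1
  rw [Matrix.mul_apply]
  split_ifs with h
  · rw [Matrix.mul_apply]
    symm
    refine Finset.sum_of_injOn (topIdx hk s q) (topIdx_injective hk s q).injOn (by simp) ?_ ?_
    · intro y _ hy
      have : scaleExp k s q y ≠ 0 := fun h0 => by
        obtain ⟨p, rfl⟩ := scaleExp_eq_zero hk h0
        exact hy ⟨p, by simp⟩
      simp [h, this]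
    · intro p _
      simp [h, scaleExp_topIdx hk]
  · refine Finset.sum_eq_zero fun y _ => ?_
    have := rowExp_le x
    have : k - rowExp k s q x + scaleExp k s q y ≠ 0 := by omega
    rw [Matrix.of_apply, Complex.ofReal_zero, zero_pow this, zero_mul, zero_mul]

theorem pencil_zero_mul_inl {k q r : ℕ} (hk : 1 ≤ k) {s : ℕ → ℕ} (B : Matrix (Fin q) (Fin q) ℂ)
    (K : Matrix (JIdx k s ⊕ Fin q) (JIdx k s ⊕ Fin q) ℂ)
    (V : Matrix (JIdx k s ⊕ Fin q) (Fin r) ℂ) (j : Finset.Icc 1 k) (m : Fin (j : ℕ))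
    (p : Fin (s j)) :
    (pencil B K 0 * V) (Sum.inl ⟨j, (m, p)⟩) =
      if h : (m : ℕ) + 1 < j then V (Sum.inl ⟨j, (⟨m + 1, h⟩, p)⟩) else
        (K.submatrix id (topIdx hk s q) * V.submatrix (topIdx hk s q) id)
          (Sum.inl ⟨j, (m, p)⟩) := by
  have hN : (fromBlocks (nilpotentPart k s) 0 0 B * V) (Sum.inl ⟨j, (m, p)⟩) =
      (nilpotentPart k s * V.submatrix Sum.inl id) ⟨j, (m, p)⟩ := by
    funext c
    simp [Matrix.mul_apply, Fintype.sum_sum_type]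
  rw [pencil_zero_mul hk, hN, nilpotentPart_mul_apply]
  have h1 := m.2
  have h2 := (Finset.mem_Icc.1 j.2).2
  by_cases h : (m : ℕ) + 1 < j
  · have : rowExp k s q (Sum.inl ⟨j, (m, p)⟩) ≠ k := by simp only [rowExp]; omega
    rw [dif_pos h, dif_pos h, if_neg this, add_zero]
    rfl
  · have : rowExp k s q (Sum.inl ⟨j, (m, p)⟩) = k := by simp only [rowExp]; omega
    rw [dif_neg h, dif_neg h, if_pos this, zero_add]

theorem pencil_zero_mul_inr {k q r : ℕ} (hk : 1 ≤ k) {s : ℕ → ℕ} (B : Matrix (Fin q) (Fin q) ℂ)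
    (K : Matrix (JIdx k s ⊕ Fin q) (JIdx k s ⊕ Fin q) ℂ)
    (V : Matrix (JIdx k s ⊕ Fin q) (Fin r) ℂ) (z : Fin q) :
    (pencil B K 0 * V) (Sum.inr z) = (B * V.submatrix Sum.inr id) z +
        (K.submatrix id (topIdx hk s q) * V.submatrix (topIdx hk s q) id) (Sum.inr z) := by
  have hN : (fromBlocks (nilpotentPart k s) 0 0 B * V) (Sum.inr z) =
      (B * V.submatrix Sum.inr id) z := by
    funext c
    simp [Matrix.mul_apply, Fintype.sum_sum_type]
  rw [pencil_zero_mul hk, hN, if_pos (show rowExp k s q (Sum.inr z) = k from rfl)]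

theorem pencilId_zero_mul_inl {k q r : ℕ} {s : ℕ → ℕ}
    (V : Matrix (JIdx k s ⊕ Fin q) (Fin r) ℂ) (x : JIdx k s) :
    (pencilId k s q 0 * V) (Sum.inl x) = V (Sum.inl x) := by
  funext c
  simp [pencilId, Matrix.diagonal_mul]

theorem pencilId_zero_mul_inr {k q r : ℕ} {s : ℕ → ℕ}
    (V : Matrix (JIdx k s ⊕ Fin q) (Fin r) ℂ) (z : Fin q) :
    (pencilId k s q 0 * V) (Sum.inr z) = 0 := by
  funext c
  simp [pencilId, Matrix.diagonal_mul]

/-! ### The limit solution and its nondegeneracy. -/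

section Leading

variable {k q r : ℕ} {s : ℕ → ℕ}

/-- The limit of the rescaled eigenvector matrix. -/
def leading (hk : 1 ≤ k) (B : Matrix (Fin q) (Fin q) ℂ)
    (K : Matrix (JIdx k s ⊕ Fin q) (JIdx k s ⊕ Fin q) ℂ) (Q : Matrix (Fin (s k)) (Fin r) ℂ)
    (Omega : Matrix (Fin r) (Fin r) ℂ) : Matrix (JIdx k s ⊕ Fin q) (Fin r) ℂ :=
  fun x => match x with
    | Sum.inl ⟨j, m, p⟩ =>
      (K.submatrix id (topIdx hk s q) * Q * Omega⁻¹ ^ ((j : ℕ) - m)) (Sum.inl ⟨j, (lastPos j, p)⟩)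
    | Sum.inr z => (-(B⁻¹ * (K.submatrix id (topIdx hk s q) * Q).submatrix Sum.inr id)) z

/-- The compression of the perturbation to the eigenvectors of the largest Jordan blocks. -/
def topBlock (hk : 1 ≤ k) (K : Matrix (JIdx k s ⊕ Fin q) (JIdx k s ⊕ Fin q) ℂ) :
    Matrix (Fin (s k)) (Fin (s k)) ℂ :=
  K.submatrix (fun p => Sum.inl ⟨top hk, (lastPos (top hk), p)⟩) (topIdx hk s q)

/-- The rows belonging to the largest Jordan blocks. -/
def topRows (hk : 1 ≤ k) (s : ℕ → ℕ) (q : ℕ) (x : Fin k × Fin (s k)) : JIdx k s ⊕ Fin q :=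
  Sum.inl ⟨top hk, x⟩

theorem invariant_blockRow (hk : 1 ≤ k) {S : Matrix (Fin q) (Fin q) ℂ}
    {Phi : Matrix (Fin k × Fin q) (Fin r) ℂ} {Omega : Matrix (Fin r) (Fin r) ℂ}
    (hPhi : blockCompanion k q S * Phi = Phi * Omega) (m : Fin k) :
    Phi.submatrix (fun p => (m, p)) id = topRow hk Phi * Omega ^ (m : ℕ) := by
  obtain ⟨m, hm⟩ := m
  induction m with
  | zero => simp [topRow]
  | succ m ih =>
    have h1 := ih (by omega)
    rw [pow_succ, ← Matrix.mul_assoc, ← h1]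
    funext p
    have h2 := blockCompanion_mul_apply hk S Phi ⟨m, by omega⟩ p
    rw [hPhi, dif_pos hm] at h2
    exact h2.symm

theorem mul_topRow_eq (hk : 1 ≤ k) {S : Matrix (Fin q) (Fin q) ℂ}
    {Phi : Matrix (Fin k × Fin q) (Fin r) ℂ} {Omega : Matrix (Fin r) (Fin r) ℂ}
    (hPhi : blockCompanion k q S * Phi = Phi * Omega) :
    S * topRow hk Phi = topRow hk Phi * Omega ^ k := by
  obtain ⟨k, rfl⟩ : ∃ k', k = k' + 1 := ⟨k - 1, by omega⟩
  have h1 := invariant_blockRow hk hPhi (Fin.last k)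
  rw [pow_succ, ← Matrix.mul_assoc]
  rw [Fin.val_last] at h1
  rw [← h1]
  funext p
  have h2 := blockCompanion_mul_apply hk S Phi (Fin.last k) p
  rw [hPhi, dif_neg (by simp)] at h2
  exact h2.symm

variable {hk : 1 ≤ k} {B : Matrix (Fin q) (Fin q) ℂ}
  {K : Matrix (JIdx k s ⊕ Fin q) (JIdx k s ⊕ Fin q) ℂ}
  {Phi : Matrix (Fin k × Fin (s k)) (Fin r) ℂ} {Omega : Matrix (Fin r) (Fin r) ℂ}

/-- On the longest chains the formula gives S Q_1 Omega^(m-k), which is Q_1 Omega^m because S Q_1 =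
Q_1 Omega^k. -/
theorem leading_submatrix_topRows (hO : IsUnit Omega)
    (hPhi : blockCompanion k (s k) (topBlock hk K) * Phi = Phi * Omega) :
    (leading hk B K (topRow hk Phi) Omega).submatrix (topRows hk s q) id = Phi := by
  funext ⟨m, p⟩
  have h1 := congrFun (invariant_blockRow hk hPhi m) p
  refine Eq.trans ?_ h1.symm
  have h2 : topRow hk Phi * Omega ^ (m : ℕ) =
      topBlock hk K * topRow hk Phi * Omega⁻¹ ^ (k - (m : ℕ)) := by
    have hOO : Omega * Omega⁻¹ = 1 :=
      Matrix.mul_nonsing_inv _ ((Matrix.isUnit_iff_isUnit_det _).1 hO)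
    have hc : Commute Omega Omega⁻¹ :=
      hOO.trans (Matrix.nonsing_inv_mul _ ((Matrix.isUnit_iff_isUnit_det _).1 hO)).symm
    have hpow : Omega ^ k = Omega ^ (m : ℕ) * Omega ^ (k - (m : ℕ)) := by
      rw [← pow_add, Nat.add_sub_cancel' m.2.le]
    rw [mul_topRow_eq hk hPhi, Matrix.mul_assoc, hpow, Matrix.mul_assoc, ← hc.mul_pow, hOO,
      one_pow, Matrix.mul_one]
  rw [h2]
  rfl

theorem leading_submatrix_topIdx (hO : IsUnit Omega)
    (hPhi : blockCompanion k (s k) (topBlock hk K) * Phi = Phi * Omega) :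
    (leading hk B K (topRow hk Phi) Omega).submatrix (topIdx hk s q) id = topRow hk Phi := by
  conv_rhs => rw [← leading_submatrix_topRows (B := B) hO hPhi]
  rfl

/-- Along a chain the equation is V_{m+1} = V_m Omega, closed at the end by K Q_1 = V_last Omega;
this forces the negative powers of Omega in `leading`. Complementary rows read B Z + K Q_1 = 0. -/
theorem pencil_mul_leading (hO : IsUnit Omega) (hB : IsUnit B)
    (hPhi : blockCompanion k (s k) (topBlock hk K) * Phi = Phi * Omega) :
    pencil B K 0 * leading hk B K (topRow hk Phi) Omega =
      pencilId k s q 0 * leading hk B K (topRow hk Phi) Omega * Omega := by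
  have hOO : Omega⁻¹ * Omega = 1 :=
    Matrix.nonsing_inv_mul _ ((Matrix.isUnit_iff_isUnit_det _).1 hO)
  set Q := topRow hk Phi with hQ
  funext x
  rw [Matrix.mul_apply_eq_vecMul (pencilId k s q 0 * leading hk B K Q Omega)]
  rcases x with ⟨j, m, p⟩ | z
  · rw [pencilId_zero_mul_inl, pencil_zero_mul_inl hk, leading_submatrix_topIdx hO hPhi]
    have hm := m.2
    have hstep : leading hk B K Q Omega (Sum.inl ⟨j, (m, p)⟩) ᵥ* Omega =
        (K.submatrix id (topIdx hk s q) * Q * Omega⁻¹ ^ ((j : ℕ) - (m + 1)))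
          (Sum.inl ⟨j, (lastPos j, p)⟩) := by
      change (K.submatrix id (topIdx hk s q) * Q * Omega⁻¹ ^ ((j : ℕ) - m))
          (Sum.inl ⟨j, (lastPos j, p)⟩) ᵥ* Omega = _
      rw [← Matrix.mul_apply_eq_vecMul, show (j : ℕ) - m = (j - (m + 1)) + 1 by omega, pow_succ,
        ← Matrix.mul_assoc, Matrix.mul_assoc _ _ Omega, hOO, Matrix.mul_one]
    rw [hstep]
    split_ifs with h
    · rfl
    · have hml : m = lastPos j := Fin.ext (by simp only [lastPos]; omega)
      rw [show (j : ℕ) - (m + 1) = 0 by omega, pow_zero, Matrix.mul_one, ← hml]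
  · rw [pencilId_zero_mul_inr, pencil_zero_mul_inr hk, leading_submatrix_topIdx hO hPhi,
      Matrix.zero_vecMul]
    have : (leading hk B K Q Omega).submatrix Sum.inr id =
        -(B⁻¹ * (K.submatrix id (topIdx hk s q) * Q).submatrix Sum.inr id) := rfl
    rw [this, Matrix.mul_neg, ← Matrix.mul_assoc,
      Matrix.mul_nonsing_inv _ ((Matrix.isUnit_iff_isUnit_det _).1 hB), Matrix.one_mul]
    exact neg_add_cancel _

theorem pencil_mul_submatrix_topRows (V : Matrix (JIdx k s ⊕ Fin q) (Fin r) ℂ) :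
    (pencil B K 0 * V).submatrix (topRows hk s q) id =
      blockCompanion k (s k) (topBlock hk K) * V.submatrix (topRows hk s q) id := by
  funext ⟨m, p⟩
  rw [blockCompanion_mul_apply hk]
  refine (pencil_zero_mul_inl hk B K V (top hk) m p).trans ?_
  have hm : (m : ℕ) < k := m.2
  by_cases h : (m : ℕ) + 1 < k
  · rw [dif_pos h, dif_pos (show (m : ℕ) + 1 < (top hk : Finset.Icc 1 k) from h)]
    rfl
  · rw [dif_neg h, dif_neg (show ¬ (m : ℕ) + 1 < (top hk : Finset.Icc 1 k) from h)]
    have hml : m = lastPos (top hk) := Fin.ext (by simp only [lastPos]; omega)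
    rw [hml]
    rfl

theorem vecMul_eq_zero_of_isUnit (hO : IsUnit Omega) {v : Fin r → ℂ} (h : v ᵥ* Omega = 0) :
    v = 0 := by
  have h1 := congrArg (· ᵥ* Omega⁻¹) h
  simpa [Matrix.vecMul_vecMul,
    Matrix.mul_nonsing_inv _ ((Matrix.isUnit_iff_isUnit_det _).1 hO)] using h1

/-- The rows of the longest chains decouple into Theta_k X - X Omega = Phi G, where `hL` applies.
Once these vanish so does the K term, and invertibility of Omega and B kills the other rows. -/
theorem pencil_linearization_injective (hO : IsUnit Omega) (hB : IsUnit B)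
    (hPhi : blockCompanion k (s k) (topBlock hk K) * Phi = Phi * Omega)
    {L : Matrix (Fin r) (Fin k × Fin (s k)) ℂ}
    (hL : ∀ (X : Matrix (Fin k × Fin (s k)) (Fin r) ℂ) (G : Matrix (Fin r) (Fin r) ℂ),
      blockCompanion k (s k) (topBlock hk K) * X - X * Omega = Phi * G → L * X = 0 →
        X = 0 ∧ G = 0)
    (V : Matrix (JIdx k s ⊕ Fin q) (Fin r) ℂ) (G : Matrix (Fin r) (Fin r) ℂ)
    (hV : pencil B K 0 * V - pencilId k s q 0 * V * Omega =
      pencilId k s q 0 * leading hk B K (topRow hk Phi) Omega * G)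
    (hLV : L * V.submatrix (topRows hk s q) id = 0) : V = 0 ∧ G = 0 := by
  have hId : ∀ M : Matrix (JIdx k s ⊕ Fin q) (Fin r) ℂ,
      (pencilId k s q 0 * M).submatrix (topRows hk s q) id = M.submatrix (topRows hk s q) id :=
    fun M => by
      funext x
      exact pencilId_zero_mul_inl M _
  have htop : V.submatrix (topRows hk s q) id = 0 ∧ G = 0 := by
    refine hL _ _ ?_ hLV
    have h1 : (pencil B K 0 * V).submatrix (topRows hk s q) id -
        (pencilId k s q 0 * V).submatrix (topRows hk s q) id * Omega =
        (pencilId k s q 0 * leading hk B K (topRow hk Phi) Omega).submatrix (topRows hk s q) id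
          * G := congrArg (fun M => M.submatrix (topRows hk s q) id) hV
    rwa [hId, hId, leading_submatrix_topRows hO hPhi, pencil_mul_submatrix_topRows] at h1
  refine ⟨?_, htop.2⟩
  rw [htop.2, Matrix.mul_zero, sub_eq_zero] at hV
  have hV0 : V.submatrix (topIdx hk s q) id = 0 := by
    funext p
    exact congrFun htop.1 (firstPos (top hk), p)
  have hrow : ∀ x, (pencil B K 0 * V) x = (pencilId k s q 0 * V) x ᵥ* Omega := fun x => by
    rw [hV, Matrix.mul_apply_eq_vecMul]
  -- Induction on the distance d from the end of the chain, moving back towards its start.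
  have hinl : ∀ (j : Finset.Icc 1 k) (p : Fin (s j)) (d : ℕ) (m : Fin (j : ℕ)),
      (m : ℕ) + 1 + d = j → V (Sum.inl ⟨j, (m, p)⟩) = 0 := by
    intro j p d
    induction d with
    | zero =>
      intro m hm
      have h1 := hrow (Sum.inl ⟨j, (m, p)⟩)
      rw [pencil_zero_mul_inl hk, pencilId_zero_mul_inl, dif_neg (by omega), hV0,
        Matrix.mul_zero] at h1
      exact vecMul_eq_zero_of_isUnit hO h1.symm
    | succ d ih =>
      intro m hm
      have h1 := hrow (Sum.inl ⟨j, (m, p)⟩)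
      rw [pencil_zero_mul_inl hk, pencilId_zero_mul_inl, dif_pos (by omega),
        ih ⟨m + 1, by omega⟩ (by simp only; omega)] at h1
      exact vecMul_eq_zero_of_isUnit hO h1.symm
  have hinr : V.submatrix Sum.inr id = 0 := by
    have h1 : B * V.submatrix Sum.inr id = 0 := by
      funext z
      have h2 := hrow (Sum.inr z)
      rw [pencil_zero_mul_inr hk, pencilId_zero_mul_inr, hV0, Matrix.mul_zero,
        Matrix.zero_vecMul] at h2
      exact (add_zero _).symm.trans h2
    have h3 := congrArg (fun M => B⁻¹ * M) h1
    simpa only [← Matrix.mul_assoc, Matrix.mul_zero, Matrix.one_mul,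
      Matrix.nonsing_inv_mul _ ((Matrix.isUnit_iff_isUnit_det _).1 hB)] using h3
  funext x
  rcases x with ⟨j, m, p⟩ | z
  · have := m.2
    exact hinl j p (j - (m + 1)) m (by omega)
  · exact congrFun hinr z

/-- L T⁻¹ Phi is a left inverse of Omega. This legitimizes the inverse powers of Omega in the limit
solution. -/
theorem isUnit_of_invariant {ι : Type*} [Fintype ι] [DecidableEq ι] {T : Matrix ι ι ℂ}
    {Phi : Matrix ι (Fin r) ℂ} {L : Matrix (Fin r) ι ℂ} (hT : IsUnit T)
    (hPhi : T * Phi = Phi * Omega) (hL : L * Phi = 1) : IsUnit Omega := by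
  have h1 : Phi = T⁻¹ * Phi * Omega := by
    rw [Matrix.mul_assoc, ← hPhi, ← Matrix.mul_assoc,
      Matrix.nonsing_inv_mul _ ((Matrix.isUnit_iff_isUnit_det _).1 hT), Matrix.one_mul]
  have h2 : (L * T⁻¹ * Phi) * Omega = 1 := by
    rw [← hL]
    conv_rhs => rw [h1]
    simp only [Matrix.mul_assoc]
  exact (Matrix.isUnit_iff_isUnit_det _).2 (Matrix.isUnit_det_of_left_inverse h2)

/-- The rescaled eigenvalue problem has a solution near its limit. -/
theorem exists_scaled_solution (hB : IsUnit B) (hS : IsUnit (topBlock hk K))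
    (hrank : Phi.rank = r)
    (hPhi : blockCompanion k (s k) (topBlock hk K) * Phi = Phi * Omega)
    (hOmega : ∀ μ ∈ Omega.charpoly.roots,
      μ ∉ (blockCompanion k (s k) (topBlock hk K)).charpoly.roots - Omega.charpoly.roots) :
    ∃ (U0 : Matrix (JIdx k s ⊕ Fin q) (Fin r) ℂ)
      (U : ℝ → Matrix (JIdx k s ⊕ Fin q) (Fin r) ℂ) (Om : ℝ → Matrix (Fin r) (Fin r) ℂ),
      U0.submatrix (topRows hk s q) id = Phi ∧
      (∀ᶠ e in 𝓝 0, (fromBlocks (nilpotentPart k s) 0 0 B + ((e : ℝ) : ℂ) ^ k • K) *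
        (scaling k s q e * U e) = scaling k s q e * U e * ((e : ℂ) • Om e)) ∧
      (∀ a b, (fun e => U e a b - U0 a b) =O[𝓝 0] fun e : ℝ => e) ∧
      (∀ a b, (fun e => Om e a b - Omega a b) =O[𝓝 0] fun e : ℝ => e) := by
  obtain ⟨L, hLPhi, hL⟩ := exists_leftInverse_of_simple_invariant hrank hPhi hOmega
  have hO := isUnit_of_invariant (isUnit_blockCompanion hk hS) hPhi hLPhi
  obtain ⟨U, Om, hU, hU1, hU2⟩ := exists_pencil_solution (G := pencil B K)
    (P := pencilId k s q) (f := topRows hk s q) (L := L)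
    (U0 := leading hk B K (topRow hk Phi) Omega) (Om := Omega)
    (fun a b => by
      have : ContDiff ℝ 1 fun e : ℝ => (e : ℂ) := Complex.ofRealCLM.contDiff
      simp only [pencil, Matrix.add_apply, Matrix.of_apply]
      fun_prop)
    (fun a b => by
      have : ContDiff ℝ 1 fun e : ℝ => (e : ℂ) := Complex.ofRealCLM.contDiff
      simp only [pencilId, Matrix.diagonal_apply]
      split_ifs
      · rcases a with a | a
        · simp only [Sum.elim_inl]; fun_prop
        · simpa only [Sum.elim_inr] using this
      · fun_prop)
    (pencil_mul_leading hO hB hPhi)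
    (by rw [leading_submatrix_topRows hO hPhi, hLPhi])
    (pencil_linearization_injective hO hB hPhi hL)
  refine ⟨_, U, Om, leading_submatrix_topRows hO hPhi, ?_, hU1, hU2⟩
  filter_upwards [hU] with e he
  rw [← Matrix.mul_assoc, unscaled_mul_scaling, Matrix.mul_assoc, he, ← Matrix.mul_assoc,
    ← Matrix.mul_assoc, rowScaling_mul_pencilId, Matrix.mul_smul, Matrix.smul_mul, Matrix.smul_mul]

end Leading

/-! ### Returning from e to t. -/

theorem tendsto_rpow_one_div {k : ℕ} (hk : 1 ≤ k) :
    Tendsto (fun t : ℝ => t ^ (1 / (k : ℝ))) (𝓝[>] 0) (𝓝 0) := by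
  have hk' : (0 : ℝ) < 1 / (k : ℝ) := by positivity
  have h := (Real.continuousAt_rpow_const 0 (1 / (k : ℝ)) (Or.inr hk'.le)).tendsto
  rw [Real.zero_rpow hk'.ne'] at h
  exact h.mono_left nhdsWithin_le_nhds

/-- Source of every error bound: n is the weight, and m is 0 for entries merely bounded or 1 for
entries within O(e) of their limit. -/
theorem isBigO_rpow_one_div {k : ℕ} (hk : 1 ≤ k) {f : ℝ → ℂ} (n m : ℕ)
    (hf : f =O[𝓝 0] fun e : ℝ => e ^ m) :
    (fun t : ℝ => ((t ^ (1 / (k : ℝ)) : ℝ) : ℂ) ^ n * f (t ^ (1 / (k : ℝ)))) =O[𝓝[>] 0]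
      fun t : ℝ => t ^ (((n : ℝ) + m) / k) := by
  have h1 := hf.comp_tendsto (tendsto_rpow_one_div hk)
  have h2 : (fun t : ℝ => ((t ^ (1 / (k : ℝ)) : ℝ) : ℂ) ^ n) =O[𝓝[>] 0]
      fun t : ℝ => (t ^ (1 / (k : ℝ))) ^ n :=
    IsBigO.of_norm_right (IsBigO.of_bound 1 (Eventually.of_forall fun t => by simp))
  refine (h2.mul h1).congr' (EventuallyEq.refl _ _) ?_
  filter_upwards [self_mem_nhdsWithin] with t ht
  have ht' : (0 : ℝ) < t := ht
  simp only [Function.comp_apply]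
  rw [← pow_add, ← Real.rpow_natCast, ← Real.rpow_mul ht'.le]
  congr 1
  push_cast
  ring

theorem isUnit_topS {n k : ℕ} {s : ℕ → ℕ} (hk : 1 ≤ k) {D : Matrix (Fin n) (Fin n) ℂ}
    {Xi Sg : Matrix (Fin n) (JIdx k s) ℂ} (hW : IsUnit (W D Xi Sg (top hk))) :
    IsUnit (topS hk D Xi Sg) := by
  let f : Fin (s k) → EIdx k s (top hk) := fun p => ⟨⟨top hk, le_rfl⟩, p⟩
  have hf : Function.Bijective f := by
    constructor
    · intro p p' h
      simpa [f] using h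
    · rintro ⟨⟨⟨j, hj⟩, h⟩, p⟩
      have h1 : k ≤ j := h
      obtain rfl : j = k := le_antisymm (Finset.mem_Icc.1 hj).2 h1
      exact ⟨p, rfl⟩
  have h : topS hk D Xi Sg =
      (W D Xi Sg (top hk)).submatrix (Equiv.ofBijective f hf) (Equiv.ofBijective f hf) := rfl
  rw [h]
  exact (Matrix.isUnit_submatrix_equiv _ _).2 hW

theorem sum_blockCol_mul {n k : ℕ} {s : ℕ → ℕ} {κ : Type*} (M : Matrix (Fin n) (JIdx k s) ℂ)
    (Y : Matrix (JIdx k s) κ ℂ) :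
    M * Y = ∑ i : Finset.Icc 1 k, blockCol M i * Y.submatrix (fun x => ⟨i, x⟩) id := by
  ext a c
  rw [Matrix.mul_apply, Fintype.sum_sigma, Matrix.sum_apply]
  rfl

/-- Writes the leading term Xi_{k1} Q_1 as Xi times a matrix supported on the rows of weight zero,
so that it can be split off from the Jordan part of H. -/
theorem subCol_top_mul {n k q r : ℕ} {s : ℕ → ℕ} (hk : 1 ≤ k) (M : Matrix (Fin n) (JIdx k s) ℂ)
    (U : Matrix (JIdx k s ⊕ Fin q) (Fin r) ℂ) :
    subCol M (top hk) (firstPos (top hk)) * U.submatrix (topIdx hk s q) id =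
      M * Matrix.of fun x c =>
        if scaleExp k s q (Sum.inl x) = 0 then U (Sum.inl x) c else 0 := by
  ext a c
  rw [Matrix.mul_apply, Matrix.mul_apply]
  refine Finset.sum_of_injOn (fun p => ⟨top hk, (firstPos (top hk), p)⟩) ?_ (by simp) ?_ ?_
  · intro p _ p' _ h
    simpa using h
  · intro y _ hy
    have : scaleExp k s q (Sum.inl y) ≠ 0 := fun h0 => by
      obtain ⟨p, hp⟩ := scaleExp_eq_zero hk h0
      exact hy ⟨p, by simp, (Sum.inl_injective hp).symm⟩
    simp [this]
  · intro p _
    have := scaleExp_topIdx (q := q) hk p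
    rw [topIdx] at this
    simp [this, topIdx, subCol]

end JordanPert

end

/-! ### Assembly in the original coordinates. -/

open JordanPert Matrix in
theorem corollary3p5 {n k q r : ℕ} (hk : 1 ≤ k) (s : ℕ → ℕ) (hs : 0 < s k)
    (A D : Matrix (Fin n) (Fin n) ℂ) (lam0 : ℂ)
    (Xi Sg : Matrix (Fin n) (JIdx k s) ℂ) (Xic Sgc : Matrix (Fin n) (Fin q) ℂ)
    (A22 : Matrix (Fin q) (Fin q) ℂ)
    -- `[Xi Xic]` is invertible and `[Sg Sgc]` is its inverse conjugate transpose
    (hinv_left : (fromCols Sg Sgc)ᴴ * fromCols Xi Xic = 1)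
    (hinv_right : fromCols Xi Xic * (fromCols Sg Sgc)ᴴ = 1)
    -- block diagonalization of `A`
    (hA : A * fromCols Xi Xic =
      fromCols Xi Xic * fromBlocks (lam0 • 1 + nilpotentPart k s) 0 0 A22)
    (hA22 : lam0 ∉ spectrum ℂ A22)
    -- the generic condition
    (hW : ∀ i : Finset.Icc 1 k, IsUnit (W D Xi Sg i))
    -- `Phi` is a basis matrix of an invariant subspace of `Theta_k`, represented by `Omega`
    (Omega : Matrix (Fin r) (Fin r) ℂ) (Phi : Matrix (Fin k × Fin (s k)) (Fin r) ℂ)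
    (hPhi_rank : Phi.rank = r)
    (hPhi : blockCompanion k (s k) (topS hk D Xi Sg) * Phi = Phi * Omega)
    -- the eigenvalues of `Omega` differ from the remaining eigenvalues of `Theta_k`
    -- (both counted with algebraic multiplicity)
    (hOmega : ∀ μ ∈ Omega.charpoly.roots,
      μ ∉ (blockCompanion k (s k) (topS hk D Xi Sg)).charpoly.roots - Omega.charpoly.roots) :
    ∃ (C : ℝ → Matrix (Fin r) (Fin r) ℂ) (H : ℝ → Matrix (Fin n) (Fin r) ℂ)
      (Hb : (i : Finset.Icc 1 k) → ℝ → Matrix (Fin (i : ℕ) × Fin (s i)) (Fin r) ℂ)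
      (E : ℝ → Matrix (Fin n) (Fin r) ℂ),
      (∀ᶠ t : ℝ in 𝓝[>] 0, (A + (t : ℂ) • D) * H t = H t * C t) ∧
      MatBigO (fun t => C t - (lam0 • 1 + ((t ^ (1 / (k : ℝ)) : ℝ) : ℂ) • Omega)) (2 / (k : ℝ)) ∧
      (∀ᶠ t : ℝ in 𝓝[>] 0,
        H t = subCol Xi (top hk) (firstPos (top hk)) * topRow hk Phi
          + ∑ i : Finset.Icc 1 k, blockCol Xi i * Hb i t + E t) ∧
      MatBigO E 1 ∧
      (∀ i : Finset.Icc 1 k, (i : ℕ) < k → ∀ m : Fin (i : ℕ),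
        MatBigO (fun t => blockRow (Hb i t) m) (1 - ((i : ℝ) - (m : ℝ)) / (k : ℝ))) ∧
      (∀ m : Fin k,
        MatBigO (fun t => blockRow (Hb (top hk) t) m -
            (if (m : ℕ) = 0 then 0
              else topRow hk Phi * (((t ^ (1 / (k : ℝ)) : ℝ) : ℂ) • Omega) ^ (m : ℕ)))
          (((m : ℝ) + 1) / (k : ℝ))) := by
  have hB : IsUnit (A22 - lam0 • (1 : Matrix (Fin q) (Fin q) ℂ)) := by
    have h := (spectrum.notMem_iff.1 hA22).neg
    rwa [neg_sub, Algebra.algebraMap_eq_smul_one] at h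
  set K := (fromCols Sg Sgc)ᴴ * D * fromCols Xi Xic with hK
  have hS : topBlock hk K = topS hk D Xi Sg := rfl
  obtain ⟨U0, U, Om, hU0, hU, hUO, hOmO⟩ := exists_scaled_solution (hk := hk) (K := K) hB
    (hS ▸ isUnit_topS hk (hW (top hk))) hPhi_rank (by rwa [hS]) (by rwa [hS])
  have hAD : ∀ c : ℂ, (A + c • D) * fromCols Xi Xic = fromCols Xi Xic *
      (lam0 • 1 + (fromBlocks (nilpotentPart k s) 0 0 (A22 - lam0 • 1) + c • K)) := by
    intro c
    have h1 : fromBlocks (lam0 • 1 + nilpotentPart k s) 0 0 A22 =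
        lam0 • 1 + fromBlocks (nilpotentPart k s) 0 0 (A22 - lam0 • 1) := by
      rw [← fromBlocks_one, fromBlocks_smul, fromBlocks_add]
      simp
    have h2 : D * fromCols Xi Xic = fromCols Xi Xic * K := by
      rw [hK, Matrix.mul_assoc (fromCols Sg Sgc)ᴴ, ← Matrix.mul_assoc (fromCols Xi Xic),
        hinv_right, Matrix.one_mul]
    rw [Matrix.add_mul, hA, h1, Matrix.smul_mul, h2, ← add_assoc, Matrix.mul_add _ _ (c • K),
      Matrix.mul_smul]
  let e : ℝ → ℝ := fun t => t ^ (1 / (k : ℝ))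
  let Y : ℝ → Matrix (JIdx k s ⊕ Fin q) (Fin r) ℂ := fun t => scaling k s q (e t) * U (e t)
  have hY : ∀ t x c, Y t x c = (e t : ℂ) ^ scaleExp k s q x * U (e t) x c := fun t x c => by
    simp only [Y, scaling, Matrix.diagonal_mul]
  have hUb : ∀ x c, (fun e => U e x c) =O[𝓝 0] fun e : ℝ => e ^ 0 := fun x c => by
    have h1 : (fun e => U e x c - U0 x c) =O[𝓝 0] fun _ : ℝ => (1 : ℝ) :=
      (hUO x c).trans ((continuous_id.tendsto (0 : ℝ)).isBigO_one ℝ)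
    simpa using h1.add (isBigO_const_const (U0 x c) one_ne_zero (𝓝 (0 : ℝ)))
  have hk0 : (k : ℝ) ≠ 0 := by positivity
  -- Z holds Q_1 in the rows of weight zero; subtracting it leaves no leading term in the first
  -- block row of H_k.
  let Z : Matrix (JIdx k s) (Fin r) ℂ := Matrix.of fun x c =>
    if scaleExp k s q (Sum.inl x) = 0 then U0 (Sum.inl x) c else 0
  refine ⟨fun t => lam0 • 1 + (e t : ℂ) • Om (e t), fun t => fromCols Xi Xic * Y t,
    fun i t => ((Y t).submatrix Sum.inl id - Z).submatrix (fun x => ⟨i, x⟩) id,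
    fun t => Xic * (Y t).submatrix Sum.inr id, ?_, ?_, ?_, ?_, ?_, ?_⟩
  · filter_upwards [(tendsto_rpow_one_div hk).eventually hU, self_mem_nhdsWithin] with t ht ht0
    have ht0' : (0 : ℝ) < t := ht0
    have hpow : ((t ^ (1 / (k : ℝ)) : ℝ) : ℂ) ^ k = t := by
      rw [← Complex.ofReal_pow, ← Real.rpow_natCast, ← Real.rpow_mul ht0'.le,
        one_div_mul_cancel hk0, Real.rpow_one]
    rw [hpow] at ht
    rw [← Matrix.mul_assoc, hAD, Matrix.mul_assoc, Matrix.add_mul]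
    rw [show (fromBlocks (nilpotentPart k s) 0 0 (A22 - lam0 • 1) + (t : ℂ) • K) * Y t =
      Y t * ((e t : ℂ) • Om (e t)) from ht]
    simp [Matrix.mul_assoc, Matrix.mul_add]
  · intro a b
    have h := isBigO_rpow_one_div hk 1 1 (f := fun e => Om e a b - Omega a b) (by
      simpa using hOmO a b)
    refine (h.congr_left fun t => ?_).trans_eventuallyEq (EventuallyEq.of_eq ?_)
    · simp only [e, Matrix.sub_apply, Matrix.add_apply, Matrix.smul_apply, smul_eq_mul, pow_one]
      ring
    · funext t
      norm_num
  · refine Eventually.of_forall fun t => ?_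
    have h1 : topRow hk Phi = U0.submatrix (topIdx hk s q) id := by
      rw [← hU0]; rfl
    rw [h1, subCol_top_mul, ← sum_blockCol_mul, ← Matrix.mul_add]
    have h2 : fromCols Xi Xic * Y t =
        Xi * (Y t).submatrix Sum.inl id + Xic * (Y t).submatrix Sum.inr id := by
      ext a c
      simp [Matrix.mul_apply, Fintype.sum_sum_type]
    refine h2.trans ?_
    congr 2
    exact (add_sub_cancel _ _).symm
  -- Complementary rows carry weight e^k = t and U stays bounded.
  · intro a c
    have hz : ∀ z, (fun t => Y t (Sum.inr z) c) =O[𝓝[>] 0] fun t : ℝ => t ^ (1 : ℝ) := fun z => by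
      have h := isBigO_rpow_one_div hk k 0 (hUb (Sum.inr z) c)
      refine (h.congr_left fun t => (hY t (Sum.inr z) c).symm).trans_eventuallyEq (EventuallyEq.of_eq ?_)
      funext t
      simp [hk0]
    simp only [Matrix.mul_apply, Matrix.submatrix_apply, id]
    exact IsBigO.fun_sum fun z _ => (hz z).const_mul_left _
  -- For i < k the weight k - i + m is positive, so Z does not contribute, and its quotient by k is
  -- 1 - (i - m)/k.
  · intro i hi m p c
    have hm := m.2
    have hd : scaleExp k s q (Sum.inl ⟨i, (m, p)⟩) = k - i + m := rfl
    have h := isBigO_rpow_one_div hk (k - i + m) 0 (hUb (Sum.inl ⟨i, (m, p)⟩) c)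
    refine (h.congr_left fun t => ?_).trans_eventuallyEq (EventuallyEq.of_eq ?_)
    · have h0 : ¬ (k - (i : ℕ) + (m : ℕ) = 0) := by omega
      simp only [blockRow, Matrix.submatrix_apply, Matrix.sub_apply, id, Z, Matrix.of_apply, hd,
        hY, if_neg h0, sub_zero]
      rfl
    · funext t
      congr 1
      rw [Nat.cast_add, Nat.cast_sub hi.le]
      field_simp
      push_cast
      ring
  -- Here the weight is e^m and U - U0 = O(e), which gives (m + 1)/k; the limit term is e^m Q_1
  -- Omega^m, removed by Z when m = 0.
  · intro m p c
    have hd : scaleExp k s q (Sum.inl ⟨top hk, (m, p)⟩) = m := by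
      simp [scaleExp, top]
    have h := isBigO_rpow_one_div hk m 1 (f := fun e => U e (Sum.inl ⟨top hk, (m, p)⟩) c -
      U0 (Sum.inl ⟨top hk, (m, p)⟩) c) (by simpa using hUO _ c)
    refine (h.congr_left fun t => ?_).trans_eventuallyEq (EventuallyEq.of_eq ?_)
    · have h1 : U0 (Sum.inl ⟨top hk, (m, p)⟩) c = (topRow hk Phi * Omega ^ (m : ℕ)) p c := by
        rw [← invariant_blockRow hk hPhi m, ← hU0]; rfl
      simp only [blockRow, Matrix.submatrix_apply, Matrix.sub_apply, id, Z, Matrix.of_apply, hd,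
        hY]
      split_ifs with h0
      · simp [h0, e]
      · rw [smul_pow, Matrix.mul_smul, Matrix.smul_apply, ← h1, smul_eq_mul, mul_sub, sub_zero]
    · funext t
      norm_num
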